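/- Let $\mathbb K$ be a field of characteristic $0$, $R=\mathbb K[x,y,z]$, and let $\mathcal A=\{\ell_1,\ldots,\ell_n\}\subset R$ be an essential line arrangement in $\mathbb P^2$: the $\ell_i$ are nonzero linear forms with $\gcd(\ell_i,\ell_j)=1$ for $i\neq j$, and the ideal $\langle \ell_1,\ldots,\ell_n\rangle$ has height $3$ (hence $n\ge 3$). Let $I_{n-2}(\mathcal A)\subset R$ be the ideal generated by all products $\ell_{i_1}\cdots\ell_{i_{n-2}}$ with $1\le i_1<\cdots<i_{n-2}\le n$. Let $\mathrm{Sing}(\mathcal A)$ be the set of points of $\mathbb P^2$ lying on at least two of the lines $V(\ell_i)$, and for $P\in\mathrm{Sing}(\mathcal A)$ let $I(P)\subset R$ be the ideal generated by the homogeneous polynomials vanishing at $P$. Then $\mathrm{Sing}(\mathcal A)=\{P_1,\ldots,P_s\}$ is finite and, with $n_j\ge 2$ the number of lines of $\mathcal A$ passing through $P_j$ and the convention $I^0=R$, $$I_{n-2}(\mathcal A)=I(P_1)^{n_1-2}\cap\cdots\cap I(P_s)^{n_s-2}\cap\langle x,y,z\rangle^{n-2},$$ and this is a primary decomposition: $\langle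 x,y,z\rangle^{n-2}$ is primary, and so is $I(P_j)^{n_j-2}$ for every $j$ with $n_j\ge 3$ (for $n_j=2$ this factor is $R$ and is omitted). -/

import Mathlib

namespace LineArrangement

variable {K : Type*} [Field K]

/-- `foldIdeal a ℓ` is the ideal `I_a` generated by all `a`-fold products
`ℓ_{i_1} ⋯ ℓ_{i_a}` with `i_1 < ⋯ < i_a` of the polynomials `ℓ_1, …, ℓ_n`.
For `a = 0` the empty product makes it the unit ideal; for `a > n` it is the zero ideal. -/
noncomputable def foldIdeal {n k : ℕ} (a : ℕ) (ℓ : Fin n → MvPolynomial (Fin k) K) :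
    Ideal (MvPolynomial (Fin k) K) :=
  Ideal.span {f | ∃ S : Finset (Fin n), S.card = a ∧ f = ∏ i ∈ S, ℓ i}

/-- A hyperplane arrangement `𝒜 = {ℓ_1, …, ℓ_n}` in `k` variables: the `ℓ_i` are linear forms
with `gcd(ℓ_i, ℓ_j) = 1` for `i ≠ j`. -/
structure IsArrangement {n k : ℕ} (ℓ : Fin n → MvPolynomial (Fin k) K) : Prop where
  linear : ∀ i, (ℓ i).IsHomogeneous 1
  ne_zero : ∀ i, ℓ i ≠ 0
  coprime : ∀ i j, i ≠ j → IsRelPrime (ℓ i) (ℓ j)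

/-- The rank of an arrangement: the height of the ideal generated by its linear forms. -/
noncomputable def rank {n k : ℕ} (ℓ : Fin n → MvPolynomial (Fin k) K) : ℕ∞ :=
  (Ideal.span (Set.range ℓ)).height

/-- An arrangement in `k` variables is essential if its rank is `k`. -/
def IsEssential {n k : ℕ} (ℓ : Fin n → MvPolynomial (Fin k) K) : Prop :=
  rank ℓ = k

/-- The polynomial `f` vanishes at the projective point `P`, i.e. at every
vector of homogeneous coordinates of `P`. -/
def VanishesAt {k : ℕ} (f : MvPolynomial (Fin k) K) (P : Projectivization K (Fin k → K)) : Prop :=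
  ∀ v ∈ P.submodule, MvPolynomial.eval v f = 0

/-- The homogeneous ideal `I(P)` of a projective point: the ideal generated by all homogeneous
polynomials vanishing at `P`. -/
noncomputable def pointIdeal {k : ℕ} (P : Projectivization K (Fin k → K)) : Ideal (MvPolynomial (Fin k) K) :=
  Ideal.span {f | (∃ d, f.IsHomogeneous d) ∧ VanishesAt f P}

/-- The (indices of the) members of the arrangement passing through `P`. -/
def through {n k : ℕ} (ℓ : Fin n → MvPolynomial (Fin k) K) (P : Projectivization K (Fin k → K)) : Set (Fin n) :=
  {i | VanishesAt (ℓ i) P}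

/-- The multiplicity `n_P`: the number of members of the arrangement passing through `P`. -/
noncomputable def mult {n k : ℕ} (ℓ : Fin n → MvPolynomial (Fin k) K)
    (P : Projectivization K (Fin k → K)) : ℕ :=
  (through ℓ P).ncard

/-- The singular locus of a line arrangement in `ℙ²`: the points of intersection of
two different lines of the arrangement. -/
def sing {n : ℕ} (ℓ : Fin n → MvPolynomial (Fin 3) K) : Set (Projectivization K (Fin 3 → K)) :=
  {P | ∃ i j, i ≠ j ∧ VanishesAt (ℓ i) P ∧ VanishesAt (ℓ j) P}

end LineArrangement

open MvPolynomial

namespace LineArrangement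

/-! For any finite family of n linear forms, the a-fold products generate the intersection, over all
spaces W of linear forms, of I(W)^(a + n_W - n), where n_W counts the members lying in W
(`mem_prodIdeal_of_forall_mem_formIdeal_pow`). One inclusion is counting. The other is induction on
n: restrict f to the hyperplane of a nonzero member ℓ, lift the resulting products to g, and write f
= g + ℓh. The quotient h then satisfies the hypotheses for the family without ℓ and for a - 1. The
division works because the powers I(W)^k are the filtration of a valuation, the t-order after
scaling the forms of W by t (`mem_formIdeal_pow_iff`); this also makes them primary. For a = n - 2
the exponent is n_W - 2. If it is positive, W contains two independent forms, so in three variables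
W is either everything or the forms vanishing at a singular point. -/

lemma exists_projection {K V : Type*} [Field K] [AddCommGroup V] [Module K V]
    (W : Submodule K V) : ∃ p : V →ₗ[K] V, (∀ c, p c ∈ W) ∧ ∀ c ∈ W, p c = c := by
  obtain ⟨g, hg⟩ := LinearMap.exists_extend (LinearMap.id : W →ₗ[K] W)
  refine ⟨W.subtype ∘ₗ g, fun c => (g c).2, fun c hc => ?_⟩
  simpa using congrArg Subtype.val (LinearMap.congr_fun hg ⟨c, hc⟩)

/-! ### Linear forms and the order of vanishing along a linear subspace -/

section LinearForms

variable {K σ : Type*} [Field K] [Fintype σ]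

/-- The linear form `∑ i, c i * X i` with coefficient vector `c`. -/
noncomputable def linForm (K σ : Type*) [Field K] [Fintype σ] :
    (σ → K) →ₗ[K] MvPolynomial σ K :=
  Fintype.linearCombination K (X : σ → MvPolynomial σ K)

lemma linForm_apply (c : σ → K) : linForm K σ c = ∑ i, c i • (X i : MvPolynomial σ K) :=
  rfl

lemma linForm_single [DecidableEq σ] (i : σ) : linForm K σ (Pi.single i 1) = X i := by
  simp [linForm, Fintype.linearCombination_apply_single]

lemma eval_linForm (v c : σ → K) : eval v (linForm K σ c) = ∑ i, c i * v i := by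
  simp [linForm_apply, smul_eval]

lemma linForm_injective : Function.Injective (linForm K σ) := by
  classical
  intro c d h
  funext i
  simpa [eval_linForm, Pi.single_apply] using congrArg (eval (Pi.single i 1 : σ → K)) h

lemma exists_linForm_eq {f : MvPolynomial σ K} (hf : f.IsHomogeneous 1) :
    ∃ c, linForm K σ c = f := by
  rw [← mem_homogeneousSubmodule, homogeneousSubmodule_one_eq_span_X,
    Submodule.mem_span_range_iff_exists_fun] at hf
  exact hf

lemma linForm_isHomogeneous (c : σ → K) : (linForm K σ c).IsHomogeneous 1 := by
  rw [← mem_homogeneousSubmodule, homogeneousSubmodule_one_eq_span_X,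
    Submodule.mem_span_range_iff_exists_fun]
  exact ⟨c, rfl⟩

lemma aeval_linForm {A : Type*} [CommRing A] [Algebra K A] (g : (σ → K) →ₗ[K] A)
    [DecidableEq σ] (c : σ → K) :
    aeval (fun i => g (Pi.single i 1)) (linForm K σ c) = g c := by
  conv_rhs => rw [pi_eq_sum_univ' c]
  simp [linForm_apply]

lemma aeval_sub_aeval_mem {K σ A : Type*} [Field K] [CommRing A] [Algebra K A] {I : Ideal A}
    {g h : σ → A} (hgh : ∀ i, g i - h i ∈ I) (f : MvPolynomial σ K) :
    aeval g f - aeval h f ∈ I := by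
  have key : (Ideal.Quotient.mkₐ K I).comp (aeval g) =
      (Ideal.Quotient.mkₐ K I).comp (aeval h) := by
    ext i
    simpa using Ideal.Quotient.eq.mpr (hgh i)
  exact Ideal.Quotient.eq.mp (DFunLike.congr_fun key f)

/-- The ideal of the linear subspace cut out by the linear forms in `W`. -/
noncomputable def formIdeal (W : Submodule K (σ → K)) : Ideal (MvPolynomial σ K) :=
  Ideal.span (linForm K σ '' W)

lemma linForm_mem_formIdeal {W : Submodule K (σ → K)} {c : σ → K} (hc : c ∈ W) :
    linForm K σ c ∈ formIdeal W :=
  Ideal.subset_span ⟨c, hc, rfl⟩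

lemma formIdeal_map_le {A : Type*} [CommRing A] (φ : MvPolynomial σ K →+* A)
    {W : Submodule K (σ → K)} {J : Ideal A} (h : ∀ c ∈ W, φ (linForm K σ c) ∈ J) :
    (formIdeal W).map φ ≤ J := by
  rw [formIdeal, Ideal.map_span, Ideal.span_le]
  rintro _ ⟨_, ⟨c, hc, rfl⟩, rfl⟩
  exact h c hc

lemma map_mem_pow {A : Type*} [CommRing A] (φ : MvPolynomial σ K →+* A)
    {W : Submodule K (σ → K)} {J : Ideal A} (h : ∀ c ∈ W, φ (linForm K σ c) ∈ J)
    {k : ℕ} {f : MvPolynomial σ K} (hf : f ∈ formIdeal W ^ k) : φ f ∈ J ^ k := by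
  have := Ideal.mem_map_of_mem φ hf
  rw [Ideal.map_pow] at this
  exact Ideal.pow_right_mono (formIdeal_map_le φ h) k this

/-- Scaling of the linear forms in the range of `p` by a new variable, fixing those in the
kernel. For a projection `p` onto `W` this measures the order along `W`. -/
noncomputable def dilation [DecidableEq σ] (p : (σ → K) →ₗ[K] (σ → K)) :
    MvPolynomial σ K →ₐ[K] Polynomial (MvPolynomial σ K) :=
  aeval fun i => Polynomial.C (linForm K σ (Pi.single i 1 - p (Pi.single i 1))) +
    Polynomial.X * Polynomial.C (linForm K σ (p (Pi.single i 1)))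

lemma dilation_linForm [DecidableEq σ] (p : (σ → K) →ₗ[K] (σ → K)) (c : σ → K) :
    dilation p (linForm K σ c) = Polynomial.C (linForm K σ (c - p c)) +
      Polynomial.X * Polynomial.C (linForm K σ (p c)) := by
  let g : (σ → K) →ₗ[K] Polynomial (MvPolynomial σ K) :=
    { toFun := fun c => Polynomial.C (linForm K σ (c - p c)) +
        Polynomial.X * Polynomial.C (linForm K σ (p c))
      map_add' := by intro a b; simp only [map_add, map_sub]; ring
      map_smul' := by
        intro a b
        simp only [map_smul, RingHom.id_apply, ← smul_sub, ← Polynomial.smul_C, smul_add,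
          mul_smul_comm] }
  exact aeval_linForm g c

lemma eval_one_dilation [DecidableEq σ] (p : (σ → K) →ₗ[K] (σ → K)) (f : MvPolynomial σ K) :
    (dilation p f).eval 1 = f := by
  have h : ((Polynomial.aeval (1 : MvPolynomial σ K)).restrictScalars K).comp (dilation p) =
      AlgHom.id K _ := by
    ext i : 1
    rw [AlgHom.comp_apply, ← linForm_single, dilation_linForm]
    simp
  have := congrArg (fun φ => φ f) h
  simpa [Polynomial.coe_aeval_eq_eval] using this

/-- The dilation of each variable has its t-coefficient in I(W), and the Rees algebra is closed
under sums and products. -/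
lemma dilation_mem_reesAlgebra [DecidableEq σ] {W : Submodule K (σ → K)}
    {p : (σ → K) →ₗ[K] (σ → K)} (hp : ∀ c, p c ∈ W) (f : MvPolynomial σ K) :
    dilation p f ∈ reesAlgebra (formIdeal W) := by
  induction f using MvPolynomial.induction_on with
  | C a =>
    have : dilation p (C a) = algebraMap (MvPolynomial σ K) _ (C a) := by
      rw [← MvPolynomial.algebraMap_eq, AlgHom.commutes]; rfl
    rw [this]
    exact Subalgebra.algebraMap_mem _ _
  | add f g hf hg => rw [map_add]; exact add_mem hf hg
  | mul_X f i hf =>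
    rw [map_mul]
    refine mul_mem hf ?_
    rw [← linForm_single, dilation_linForm]
    refine add_mem (Subalgebra.algebraMap_mem _ _) ?_
    rw [mul_comm, Polynomial.C_mul_X_eq_monomial]
    exact reesAlgebra.monomial_mem.mpr (by simpa using linForm_mem_formIdeal (hp _))

/-- Dilation multiplies each form of W by t. Conversely, the coefficient of t^i lies in I(W)^i, and
setting t = 1 recovers f. -/
lemma mem_formIdeal_pow_iff [DecidableEq σ] {W : Submodule K (σ → K)}
    {p : (σ → K) →ₗ[K] (σ → K)} (hp : ∀ c, p c ∈ W) (hpW : ∀ c ∈ W, p c = c) {k : ℕ}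
    {f : MvPolynomial σ K} :
    f ∈ formIdeal W ^ k ↔ Polynomial.X ^ k ∣ dilation p f := by
  constructor
  · intro hf
    rw [← Ideal.mem_span_singleton, ← Ideal.span_singleton_pow]
    refine map_mem_pow (dilation p).toRingHom (fun c hc => ?_) hf
    rw [Ideal.mem_span_singleton]
    simp [dilation_linForm, hpW c hc]
  · intro hf
    rw [← eval_one_dilation p f, Polynomial.eval_eq_sum_range]
    refine Ideal.sum_mem _ fun i _ => ?_
    rw [one_pow, mul_one]
    by_cases hi : i < k
    · rw [Polynomial.X_pow_dvd_iff.mp hf i hi]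
      exact zero_mem _
    · exact Ideal.pow_le_pow_right (not_lt.mp hi)
        ((mem_reesAlgebra_iff _ _).mp (dilation_mem_reesAlgebra hp f) i)

/-- Since t is prime, a factor whose dilation it does not divide can be cancelled from t^k. -/
lemma mem_pow_of_mul_mem_pow {W : Submodule K (σ → K)} {k : ℕ} {f g : MvPolynomial σ K}
    (h : f * g ∈ formIdeal W ^ k) (hf : f ∉ formIdeal W) : g ∈ formIdeal W ^ k := by
  classical
  obtain ⟨p, hp, hpW⟩ := exists_projection W
  rw [← pow_one (formIdeal W)] at hf
  rw [mem_formIdeal_pow_iff hp hpW] at h hf ⊢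
  rw [pow_one] at hf
  rw [map_mul] at h
  exact Polynomial.prime_X.pow_dvd_of_dvd_mul_left k hf h

lemma linForm_mem_formIdeal_iff {W : Submodule K (σ → K)} {c : σ → K} :
    linForm K σ c ∈ formIdeal W ↔ c ∈ W := by
  classical
  refine ⟨fun h => ?_, linForm_mem_formIdeal⟩
  obtain ⟨p, hp, hpW⟩ := exists_projection W
  rw [← pow_one (formIdeal W), mem_formIdeal_pow_iff hp hpW, pow_one, dilation_linForm,
    Polynomial.X_dvd_iff] at h
  have h0 : c - p c = 0 := linForm_injective (by simpa using h)
  rw [sub_eq_zero.mp h0]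
  exact hp c

/-- A nonzero form of W has t-order exactly one: it dilates to t times itself. -/
lemma mem_pow_of_linForm_mul_mem_pow {W : Submodule K (σ → K)} {k : ℕ} {c : σ → K}
    {g : MvPolynomial σ K} (hc : c ≠ 0) (hcW : c ∈ W)
    (h : linForm K σ c * g ∈ formIdeal W ^ (k + 1)) : g ∈ formIdeal W ^ k := by
  classical
  obtain ⟨p, hp, hpW⟩ := exists_projection W
  rw [mem_formIdeal_pow_iff hp hpW] at h ⊢
  rw [map_mul, dilation_linForm, hpW c hcW, sub_self, map_zero, map_zero, zero_add, pow_succ',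
    mul_assoc] at h
  refine Polynomial.prime_X.pow_dvd_of_dvd_mul_left k ?_
    ((mul_dvd_mul_iff_left Polynomial.X_ne_zero).mp h)
  rw [Polynomial.X_dvd_iff, Polynomial.coeff_C_zero]
  exact fun h0 => hc (linForm_injective (by simpa using h0))

lemma formIdeal_ne_top (W : Submodule K (σ → K)) : formIdeal W ≠ ⊤ := by
  classical
  obtain ⟨p, hp, hpW⟩ := exists_projection W
  rw [Ideal.ne_top_iff_one, ← pow_one (formIdeal W), mem_formIdeal_pow_iff hp hpW, pow_one,
    map_one]
  exact fun h => Polynomial.prime_X.not_isUnit (isUnit_of_dvd_one h)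

lemma formIdeal_pow_isPrimary (W : Submodule K (σ → K)) {k : ℕ} (hk : k ≠ 0) :
    (formIdeal W ^ k).IsPrimary := by
  rw [Ideal.isPrimary_iff]
  refine ⟨fun h => formIdeal_ne_top W (top_le_iff.mp (h ▸ Ideal.pow_le_self hk)),
    fun {f g} h => ?_⟩
  by_cases hg : g ∈ formIdeal W
  · exact Or.inr ⟨k, Ideal.pow_mem_pow hg k⟩
  · exact Or.inl (mem_pow_of_mul_mem_pow (mul_comm f g ▸ h) hg)

end LinearForms

/-! ### Counting forms in a subspace under deletion -/

section Multiplicity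

variable {K V ι : Type*} [Field K] [AddCommGroup V] [Module K V]

open Classical in
/-- The number of the linear forms `c i`, `i ∈ s`, lying in `W`. -/
noncomputable def multIn (s : Finset ι) (c : ι → V) (W : Submodule K V) : ℕ :=
  (s.filter fun i => c i ∈ W).card

lemma multIn_le (s : Finset ι) (c : ι → V) (W : Submodule K V) :
    multIn s c W ≤ s.card := by
  classical
  exact Finset.card_filter_le _ _

lemma multIn_erase_of_mem [DecidableEq ι] {s : Finset ι} {c : ι → V}
    {W : Submodule K V} {e : ι} (he : e ∈ s) (hW : c e ∈ W) :
    multIn (s.erase e) c W + 1 = multIn s c W := by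
  classical
  unfold multIn
  rw [Finset.filter_erase]
  exact Finset.card_erase_add_one (by simp [he, hW])

lemma multIn_erase_of_notMem [DecidableEq ι] {s : Finset ι} {c : ι → V}
    {W : Submodule K V} {e : ι} (hW : c e ∉ W) :
    multIn (s.erase e) c W = multIn s c W := by
  classical
  unfold multIn
  rw [Finset.filter_erase, Finset.erase_eq_of_notMem (by simp [hW])]

end Multiplicity

/-! ### Ideals of fold products, by deletion and restriction -/

section FoldProducts

variable {K σ ι : Type*} [Field K] [Fintype σ]

/-- The ideal of `a`-fold products of the linear forms with coefficient vectors `c i`,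
`i ∈ s`. -/
noncomputable def prodIdeal (a : ℕ) (s : Finset ι) (c : ι → σ → K) :
    Ideal (MvPolynomial σ K) :=
  Ideal.span {f | ∃ T ⊆ s, T.card = a ∧ f = ∏ i ∈ T, linForm K σ (c i)}

lemma prodIdeal_mono {a : ℕ} {s t : Finset ι} (c : ι → σ → K) (h : s ⊆ t) :
    prodIdeal a s c ≤ prodIdeal a t c :=
  Ideal.span_mono fun _ ⟨T, hT, hTa, hf⟩ => ⟨T, hT.trans h, hTa, hf⟩

lemma prodIdeal_zero (s : Finset ι) (c : ι → σ → K) : prodIdeal 0 s c = ⊤ :=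
  (Ideal.eq_top_iff_one _).mpr (Ideal.subset_span ⟨∅, by simp, by simp, by simp⟩)

lemma linForm_mul_mem_prodIdeal [DecidableEq ι] {a : ℕ} {s : Finset ι} {c : ι → σ → K} {e : ι}
    (he : e ∈ s) {h : MvPolynomial σ K} (hh : h ∈ prodIdeal a (s.erase e) c) :
    linForm K σ (c e) * h ∈ prodIdeal (a + 1) s c := by
  suffices prodIdeal a (s.erase e) c ≤
      Submodule.comap (LinearMap.mulLeft (MvPolynomial σ K) (linForm K σ (c e)))
        (prodIdeal (a + 1) s c) from this hh
  refine Ideal.span_le.mpr ?_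
  rintro _ ⟨T, hT, hTa, rfl⟩
  have heT : e ∉ T := fun h' => Finset.notMem_erase e s (hT h')
  refine Ideal.subset_span ⟨insert e T, ?_, ?_, ?_⟩
  · exact Finset.insert_subset he (hT.trans (Finset.erase_subset _ _))
  · rw [Finset.card_insert_of_notMem heT, hTa]
  · rw [Finset.prod_insert heT]; rfl

/-- A product of a forms omits n - a members, hence keeps at least n_W - (n - a) of those in W. -/
lemma prodIdeal_le_formIdeal_pow (a : ℕ) (s : Finset ι) (c : ι → σ → K)
    (W : Submodule K (σ → K)) :
    prodIdeal a s c ≤ formIdeal W ^ (a + multIn s c W - s.card) := by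
  classical
  refine Ideal.span_le.mpr ?_
  rintro _ ⟨T, hT, rfl, rfl⟩
  have hcard : T.card + multIn s c W - s.card ≤ (T.filter fun i => c i ∈ W).card := by
    have h1 := Finset.card_filter_add_card_filter_not (s := T) (fun i => c i ∈ W)
    have h2 := Finset.card_filter_add_card_filter_not (s := s) (fun i => c i ∈ W)
    have h3 := Finset.card_le_card (Finset.filter_subset_filter (fun i => c i ∉ W) hT)
    simp only [multIn]
    omega
  refine Ideal.pow_le_pow_right hcard ?_
  rw [← Finset.prod_filter_mul_prod_filter_not T (fun i => c i ∈ W), ← Finset.prod_const]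
  exact Ideal.mul_mem_right _ _ (Ideal.prod_mem_prod fun i hi =>
    linForm_mem_formIdeal (Finset.mem_filter.mp hi).2)

/-- Base case, decided by W = ⊥: every form lies in it and its ideal is zero, so f = 0 unless a = 0.
-/
lemma mem_prodIdeal_of_forall_eq_zero {a : ℕ} {s : Finset ι} {c : ι → σ → K}
    {f : MvPolynomial σ K} (hc : ∀ i ∈ s, c i = 0)
    (hf : ∀ W, f ∈ formIdeal W ^ (a + multIn s c W - s.card)) : f ∈ prodIdeal a s c := by
  obtain _ | a := a
  · simp [prodIdeal_zero]
  have hbot : formIdeal (⊥ : Submodule K (σ → K)) = ⊥ := by simp [formIdeal]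
  have hm : multIn s c (⊥ : Submodule K (σ → K)) = s.card := by
    classical
    unfold multIn
    rw [Finset.filter_true_of_mem (by simpa using hc)]
  have h := hf ⊥
  rw [hm, Nat.add_sub_cancel, hbot, Ideal.bot_pow a.succ_ne_zero, Ideal.mem_bot] at h
  simp [h]

/-- A linear retraction along the line spanned by `c`. -/
lemma exists_restriction {K σ : Type*} [Field K] {c : σ → K} (hc : c ≠ 0) :
    ∃ ρ : (σ → K) →ₗ[K] (σ → K), ρ c = 0 ∧ ∀ d, ∃ t : K, d - ρ d = t • c := by
  obtain ⟨i, hi⟩ := Function.ne_iff.mp hc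
  refine ⟨LinearMap.id - ((c i)⁻¹ • LinearMap.proj i).smulRight c, ?_,
    fun d => ⟨(c i)⁻¹ * d i, by simp⟩⟩
  have : c i ≠ 0 := hi
  simp [this]

lemma exists_algHom_of_restriction {c : σ → K} {ρ : (σ → K) →ₗ[K] (σ → K)}
    (hρ : ∀ d, ∃ t : K, d - ρ d = t • c) :
    ∃ φ : MvPolynomial σ K →ₐ[K] MvPolynomial σ K,
      (∀ d, φ (linForm K σ d) = linForm K σ (ρ d)) ∧
      ∀ f, f - φ f ∈ Ideal.span {linForm K σ c} := by
  classical
  refine ⟨_, aeval_linForm (linForm K σ ∘ₗ ρ), fun f => ?_⟩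
  have := aeval_sub_aeval_mem (I := Ideal.span {linForm K σ c}) (g := X)
    (h := fun i => (linForm K σ ∘ₗ ρ) (Pi.single i 1)) (fun i => ?_) f
  · rwa [aeval_X_left_apply] at this
  · obtain ⟨t, ht⟩ := hρ (Pi.single i 1)
    rw [← linForm_single, LinearMap.comp_apply, ← map_sub, ht, map_smul, smul_eq_C_mul]
    exact Ideal.mul_mem_left _ _ (Ideal.mem_span_singleton_self _)

/-- The `a`-fold products of a family of linear forms generate the intersection of the powers
`I(X) ^ (a + n_X - n)` over all linear subspaces `X`, where `n_X` of the `n` forms vanish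
on `X`. -/
theorem mem_prodIdeal_of_forall_mem_formIdeal_pow [DecidableEq ι] {a : ℕ} {s : Finset ι}
    {c : ι → σ → K} {f : MvPolynomial σ K}
    (hf : ∀ W, f ∈ formIdeal W ^ (a + multIn s c W - s.card)) : f ∈ prodIdeal a s c := by
  induction hn : s.card generalizing s a c f with
  | zero =>
    refine mem_prodIdeal_of_forall_eq_zero (fun i hi => ?_) hf
    simp [Finset.card_eq_zero.mp hn] at hi
  | succ n ih =>
    by_cases hzero : ∀ i ∈ s, c i = 0
    · exact mem_prodIdeal_of_forall_eq_zero hzero hf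
    push Not at hzero
    obtain ⟨e, he, hce⟩ := hzero
    obtain _ | b := a
    · simp [prodIdeal_zero]
    have hcard : (s.erase e).card = n := by rw [Finset.card_erase_of_mem he, hn]; rfl
    obtain ⟨ρ, hρe, hρ⟩ := exists_restriction hce
    obtain ⟨φ, hφ, hφf⟩ := exists_algHom_of_restriction hρ
    -- Restriction may create zero or repeated forms, which the induction allows. The preimage of W
    -- contains one extra form, `c e`, offsetting the drop in the size of the family.
    have h1 : φ f ∈ prodIdeal (b + 1) (s.erase e) fun i => ρ (c i) := by
      refine ih (fun W => ?_) hcard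
      have hmem : c e ∈ W.comap ρ := by simp [hρe]
      have hm : multIn (s.erase e) (fun i => ρ (c i)) W + 1 = multIn s c (W.comap ρ) :=
        multIn_erase_of_mem he hmem
      have := map_mem_pow φ.toRingHom (J := formIdeal W)
        (fun d hd => by simpa [hφ] using linForm_mem_formIdeal (by simpa using hd))
        (hf (W.comap ρ))
      rwa [← hm, hn, ← add_assoc, Nat.add_sub_add_right, ← hcard] at this
    have h2 : (prodIdeal (b + 1) (s.erase e) fun i => ρ (c i)) ≤
        prodIdeal (b + 1) (s.erase e) c ⊔ Ideal.span {linForm K σ (c e)} := by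
      refine Ideal.span_le.mpr ?_
      rintro _ ⟨T, hT, hTb, rfl⟩
      simp only [← hφ, ← map_prod]
      rw [SetLike.mem_coe, ← sub_sub_cancel (∏ i ∈ T, linForm K σ (c i)) (φ _)]
      exact sub_mem (Ideal.mem_sup_left (Ideal.subset_span ⟨T, hT, hTb, rfl⟩))
        (Ideal.mem_sup_right (hφf _))
    have h3 : f ∈ prodIdeal (b + 1) (s.erase e) c ⊔ Ideal.span {linForm K σ (c e)} := by
      rw [← sub_add_cancel f (φ f)]
      exact add_mem (Ideal.mem_sup_right (hφf _)) (h2 h1)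
    obtain ⟨g, hg, _, hh, hgh⟩ := Submodule.mem_sup.mp h3
    obtain ⟨h, rfl⟩ := Ideal.mem_span_singleton'.mp hh
    have hgs := prodIdeal_mono c (Finset.erase_subset e s) hg
    rw [← hgh, mul_comm h]
    refine add_mem hgs (linForm_mul_mem_prodIdeal he (ih (fun W => ?_) hcard))
    -- The product ℓh = f - g inherits the hypotheses, since g satisfies them by the easy inclusion.
    have hmul : linForm K σ (c e) * h ∈ formIdeal W ^ (b + 1 + multIn s c W - s.card) := by
      have := sub_mem (hf W) (prodIdeal_le_formIdeal_pow _ s c W hgs)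
      rwa [← hgh, add_sub_cancel_left, mul_comm] at this
    by_cases hW : c e ∈ W
    · rw [← multIn_erase_of_mem he hW, hn, ← add_assoc, Nat.add_sub_add_right] at hmul
      rw [hcard]
      -- If the subtraction truncates, the required power is the unit ideal; otherwise dividing by ℓ
      -- lowers the exponent by one.
      obtain hlt | hle := Nat.lt_or_ge (b + multIn (s.erase e) c W) n
      · simp [Nat.sub_eq_zero_of_le hlt.le]
      · rw [add_right_comm, Nat.sub_add_comm hle] at hmul
        exact mem_pow_of_linForm_mul_mem_pow hce hW hmul
    · rw [← multIn_erase_of_notMem hW, hn, add_right_comm, Nat.add_sub_add_right, ← hcard] at hmul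
      exact mem_pow_of_mul_mem_pow hmul (linForm_mem_formIdeal_iff.not.mpr hW)

end FoldProducts

/-! ### Projective points and line arrangements -/

section Points

variable {K : Type*} [Field K] {k n : ℕ}

/-- The coefficient vectors of the linear forms vanishing at `P`. -/
noncomputable def formsAt (P : Projectivization K (Fin k → K)) : Submodule K (Fin k → K) :=
  LinearMap.ker (Fintype.linearCombination K P.rep)

lemma mem_formsAt {P : Projectivization K (Fin k → K)} {c : Fin k → K} :
    c ∈ formsAt P ↔ ∑ i, c i * P.rep i = 0 := by
  simp [formsAt, Fintype.linearCombination_apply]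

lemma vanishesAt_linForm {P : Projectivization K (Fin k → K)} {c : Fin k → K} :
    VanishesAt (linForm K (Fin k) c) P ↔ c ∈ formsAt P := by
  rw [mem_formsAt]
  constructor
  · intro h
    rw [← eval_linForm]
    exact h _ (by rw [Projectivization.submodule_eq]; exact Submodule.mem_span_singleton_self _)
  · intro h v hv
    rw [Projectivization.submodule_eq, Submodule.mem_span_singleton] at hv
    obtain ⟨t, rfl⟩ := hv
    simp [eval_linForm, mul_left_comm _ t, ← Finset.mul_sum, h]

lemma formsAt_ne_top (P : Projectivization K (Fin k → K)) : formsAt P ≠ ⊤ := by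
  intro h
  refine P.rep_nonzero (funext fun i => ?_)
  have : Pi.single i 1 ∈ formsAt P := h ▸ Submodule.mem_top
  simpa [mem_formsAt, Pi.single_apply] using this

lemma aeval_smul_of_isHomogeneous {σ A : Type*} [CommRing A] [Algebra K A]
    {f : MvPolynomial σ K} {d : ℕ} (hf : f.IsHomogeneous d) (v : σ → K) (q : A) :
    aeval (fun i => v i • q) f = eval v f • q ^ d := by
  rw [aeval_def, eval₂_eq, eval_eq, Finset.sum_smul]
  refine Finset.sum_congr rfl fun m hm => ?_
  have hd : ∑ i ∈ m.support, m i = d := by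
    rw [← Finsupp.degree_apply]
    exact (hf.degree_eq_sum_deg_support hm).symm
  simp only [smul_pow, Finset.prod_smul, Finset.prod_pow_eq_pow_sum, hd]
  rw [mul_smul, Algebra.smul_def (coeff m f)]

/-- Modulo the forms vanishing at P, each variable X_i equals P_i (X_j / P_j) where P_j ≠ 0. A
homogeneous f of degree d thus becomes f(P) (X_j / P_j)^d, which is zero if f vanishes at P. -/
lemma pointIdeal_eq_formIdeal (P : Projectivization K (Fin k → K)) :
    pointIdeal P = formIdeal (formsAt P) := by
  apply le_antisymm
  · refine Ideal.span_le.mpr ?_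
    rintro f ⟨⟨d, hd⟩, hf⟩
    obtain ⟨j, hj⟩ := Function.ne_iff.mp P.rep_nonzero
    have hj : P.rep j ≠ 0 := hj
    have h := aeval_sub_aeval_mem (I := formIdeal (formsAt P)) (g := X)
      (h := fun i => P.rep i • ((P.rep j)⁻¹ • (X j : MvPolynomial (Fin k) K))) (fun i => ?_) f
    · have h0 : eval P.rep f = 0 :=
        hf _ (by rw [Projectivization.submodule_eq]; exact Submodule.mem_span_singleton_self _)
      rwa [aeval_X_left_apply, aeval_smul_of_isHomogeneous hd, h0, zero_smul, sub_zero] at h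
    · rw [← linForm_single, ← linForm_single, ← map_smul, ← map_smul, ← map_sub]
      refine linForm_mem_formIdeal ?_
      simp [mem_formsAt, Pi.single_apply, sub_mul, hj]
  · refine Ideal.span_mono ?_
    rintro _ ⟨c, hc, rfl⟩
    exact ⟨⟨1, linForm_isHomogeneous c⟩, vanishesAt_linForm.mpr hc⟩

lemma mult_eq_multIn {ℓ : Fin n → MvPolynomial (Fin k) K} {c : Fin n → Fin k → K}
    (hc : ∀ i, linForm K (Fin k) (c i) = ℓ i) (P : Projectivization K (Fin k → K)) :
    mult ℓ P = multIn Finset.univ c (formsAt P) := by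
  classical
  rw [mult, multIn, ← Set.ncard_coe_finset]
  congr 1
  ext i
  simp [through, ← hc, vanishesAt_linForm]

lemma foldIdeal_eq_prodIdeal {ℓ : Fin n → MvPolynomial (Fin k) K} {c : Fin n → Fin k → K}
    (hc : ∀ i, linForm K (Fin k) (c i) = ℓ i) (a : ℕ) :
    foldIdeal a ℓ = prodIdeal a Finset.univ c := by
  simp [foldIdeal, prodIdeal, hc]

lemma formIdeal_top : formIdeal (⊤ : Submodule K (Fin 3 → K)) =
    Ideal.span {X 0, X 1, X 2} := by
  apply le_antisymm
  · refine Ideal.span_le.mpr ?_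
    rintro _ ⟨c, -, rfl⟩
    rw [linForm_apply, SetLike.mem_coe]
    refine sum_mem fun i _ => Submodule.smul_of_tower_mem _ _ (Ideal.subset_span ?_)
    fin_cases i <;> simp
  · refine Ideal.span_le.mpr ?_
    rintro _ (rfl | rfl | rfl) <;>
    · rw [← linForm_single]
      exact linForm_mem_formIdeal trivial

lemma IsArrangement.linearIndependent_pair {ℓ : Fin n → MvPolynomial (Fin k) K}
    (hℓ : IsArrangement ℓ) {c : Fin n → Fin k → K}
    (hc : ∀ i, linForm K (Fin k) (c i) = ℓ i) {i j : Fin n} (hij : i ≠ j) :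
    LinearIndependent K ![c i, c j] := by
  rw [LinearIndependent.pair_iff' (fun h => hℓ.ne_zero i (by rw [← hc, h, map_zero]))]
  intro t ht
  have hdvd : ℓ i ∣ ℓ j := by
    rw [← hc j, ← ht, map_smul, hc, smul_eq_C_mul]
    exact dvd_mul_left _ _
  have hdeg := (hℓ.linear i).totalDegree (hℓ.ne_zero i)
  rw [(isUnit_iff_totalDegree_of_isReduced.mp (hℓ.coprime i j hij dvd_rfl hdvd)).2] at hdeg
  exact zero_ne_one hdeg

lemma two_le_finrank {V : Type*} [AddCommGroup V] [Module K V] [FiniteDimensional K V]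
    {W : Submodule K V} {a b : V} (hab : LinearIndependent K ![a, b]) (ha : a ∈ W)
    (hb : b ∈ W) : 2 ≤ Module.finrank K W := by
  have h := finrank_span_eq_card hab
  rw [Fintype.card_fin] at h
  refine h.symm.trans_le (Submodule.finrank_mono (Submodule.span_le.mpr ?_))
  rintro _ ⟨x, rfl⟩
  fin_cases x <;> assumption

lemma eq_formsAt {P : Projectivization K (Fin 3 → K)} {W : Submodule K (Fin 3 → K)}
    (h2 : 2 ≤ Module.finrank K W) (hW : W ≤ formsAt P) : W = formsAt P := by
  refine Submodule.eq_of_le_of_finrank_le hW (le_trans ?_ h2)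
  have := Submodule.finrank_lt (formsAt_ne_top P)
  rw [Module.finrank_fin_fun] at this
  omega

/-- A proper W lies in the kernel of a nonzero functional, whose values on the standard basis are
coordinates of P. -/
lemma exists_le_formsAt {W : Submodule K (Fin k → K)} (hW : W ≠ ⊤) :
    ∃ P, W ≤ formsAt P := by
  obtain ⟨φ, hφ, hle⟩ := W.exists_le_ker_of_lt_top (lt_top_iff_ne_top.mpr hW)
  have hφ_eq : ∀ c, φ c = ∑ i, c i * φ (Pi.single i 1) := fun c => by
    conv_lhs => rw [pi_eq_sum_univ' c]
    simp
  have hv : (fun i => φ (Pi.single i 1)) ≠ 0 := fun h => hφ <| LinearMap.ext fun c => by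
    rw [hφ_eq]
    simp [fun i => congrFun h i]
  refine ⟨Projectivization.mk K _ hv, fun c hc => ?_⟩
  rw [← vanishesAt_linForm]
  intro w hw
  rw [Projectivization.submodule_mk, Submodule.mem_span_singleton] at hw
  obtain ⟨t, rfl⟩ := hw
  have h0 : ∑ i, c i * φ (Pi.single i 1) = 0 := (hφ_eq c).symm.trans (hle hc)
  rw [eval_linForm]
  simp [mul_left_comm _ t, ← Finset.mul_sum, h0]

lemma formsAt_injective : Function.Injective (formsAt (K := K) (k := k)) := by
  intro P Q h
  obtain ⟨j, hj⟩ := Function.ne_iff.mp Q.rep_nonzero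
  have hj : Q.rep j ≠ 0 := hj
  rw [← P.mk_rep, ← Q.mk_rep, Projectivization.mk_eq_mk_iff']
  refine ⟨(Q.rep j)⁻¹ * P.rep j, funext fun i => ?_⟩
  -- The 2×2 minor Q_j X_i - Q_i X_j vanishes at Q, hence at P, which makes the coordinates
  -- proportional.
  have hmem : Q.rep j • Pi.single i 1 - Q.rep i • Pi.single j 1 ∈ formsAt Q := by
    simp [mem_formsAt, Pi.single_apply, sub_mul, mul_comm]
  rw [← h] at hmem
  have := sub_eq_zero.mp (by simpa [mem_formsAt, Pi.single_apply, sub_mul] using hmem)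
  rw [Pi.smul_apply, smul_eq_mul, mul_assoc, mul_comm (P.rep j), ← this,
    inv_mul_cancel_left₀ hj]

lemma sing_finite {ℓ : Fin n → MvPolynomial (Fin 3) K} (hℓ : IsArrangement ℓ) :
    (sing ℓ).Finite := by
  choose c hc using fun i => exists_linForm_eq (hℓ.linear i)
  refine Set.Finite.of_finite_image (f := formsAt) (Set.Finite.subset (Set.finite_range
    fun ij : Fin n × Fin n => Submodule.span K {c ij.1, c ij.2}) ?_) formsAt_injective.injOn
  rintro _ ⟨P, ⟨i, j, hij, hi, hj⟩, rfl⟩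
  rw [← hc, vanishesAt_linForm] at hi hj
  refine ⟨(i, j), eq_formsAt (two_le_finrank (hℓ.linearIndependent_pair hc hij) ?_ ?_) ?_⟩
  · exact Submodule.subset_span (by simp)
  · exact Submodule.subset_span (by simp)
  · exact Submodule.span_le.mpr (Set.insert_subset hi (Set.singleton_subset_iff.mpr hj))

lemma two_le_mult {ℓ : Fin n → MvPolynomial (Fin 3) K} {P : Projectivization K (Fin 3 → K)}
    (hP : P ∈ sing ℓ) : 2 ≤ mult ℓ P := by
  obtain ⟨i, j, hij, hi, hj⟩ := hP
  exact (Set.one_lt_ncard (Set.toFinite _)).mpr ⟨i, hi, j, hj, hij⟩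

/-- Krull's height theorem; for an essential line arrangement it gives n ≥ 3. -/
lemma rank_le {ℓ : Fin n → MvPolynomial (Fin k) K} (hℓ : IsArrangement ℓ) : rank ℓ ≤ n := by
  choose c hc using fun i => exists_linForm_eq (hℓ.linear i)
  have htop : Ideal.span (Set.range ℓ) ≠ ⊤ := fun h =>
    formIdeal_ne_top (⊤ : Submodule K (Fin k → K)) <| top_le_iff.mp <| h ▸ Ideal.span_le.mpr
      (by rintro _ ⟨i, rfl⟩; rw [← hc]; exact linForm_mem_formIdeal trivial)
  refine (Ideal.height_le_spanFinrank _ htop).trans (Nat.cast_le.mpr ?_)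
  refine (Submodule.spanFinrank_span_le_ncard_of_finite (Set.finite_range ℓ)).trans ?_
  rw [← Set.image_univ]
  exact (Set.ncard_image_le Set.finite_univ).trans (by simp)

theorem foldIdeal_eq_iInf_inf {ℓ : Fin n → MvPolynomial (Fin 3) K} (hℓ : IsArrangement ℓ)
    (hn : 2 ≤ n) :
    foldIdeal (n - 2) ℓ = (⨅ P ∈ sing ℓ, pointIdeal P ^ (mult ℓ P - 2)) ⊓
      Ideal.span {X 0, X 1, X 2} ^ (n - 2) := by
  classical
  choose c hc using fun i => exists_linForm_eq (hℓ.linear i)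
  rw [foldIdeal_eq_prodIdeal hc]
  have hexp : ∀ m, n - 2 + m - (Finset.univ : Finset (Fin n)).card = m - 2 := fun m => by
    rw [Finset.card_univ, Fintype.card_fin]
    omega
  apply le_antisymm
  · refine le_inf (le_iInf₂ fun P _ => ?_) ?_
    · rw [pointIdeal_eq_formIdeal, mult_eq_multIn hc, ← hexp (multIn Finset.univ c (formsAt P))]
      exact prodIdeal_le_formIdeal_pow _ _ _ _
    · have htop : multIn Finset.univ c (⊤ : Submodule K (Fin 3 → K)) = n := by
        classical
        simp [multIn]
      have := prodIdeal_le_formIdeal_pow (n - 2) Finset.univ c (⊤ : Submodule K (Fin 3 → K))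
      rwa [hexp, htop, formIdeal_top] at this
  · rintro f ⟨hfP, hf0⟩
    simp only [SetLike.mem_coe, Submodule.mem_iInf] at hfP hf0
    refine mem_prodIdeal_of_forall_mem_formIdeal_pow fun W => ?_
    rw [hexp]
    -- With at most two forms in W the exponent is zero; with more, two independent ones force dim W
    -- ≥ 2.
    obtain hle | hlt := le_or_gt (multIn Finset.univ c W) 2
    · simp [Nat.sub_eq_zero_of_le hle]
    obtain rfl | hW := eq_or_ne W ⊤
    · rw [formIdeal_top]
      refine Ideal.pow_le_pow_right (Nat.sub_le_sub_right ?_ 2) hf0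
      simpa using multIn_le Finset.univ c (⊤ : Submodule K (Fin 3 → K))
    obtain ⟨P, hWP⟩ := exists_le_formsAt hW
    obtain ⟨i, hi, j, hj, hij⟩ := Finset.one_lt_card.mp (one_lt_two.trans hlt)
    replace hi : c i ∈ W := (Finset.mem_filter.mp hi).2
    replace hj : c j ∈ W := (Finset.mem_filter.mp hj).2
    have h2 : 2 ≤ Module.finrank K W :=
      two_le_finrank (hℓ.linearIndependent_pair hc hij) hi hj
    have hP : P ∈ sing ℓ := ⟨i, j, hij, by rw [← hc, vanishesAt_linForm]; exact hWP hi,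
      by rw [← hc, vanishesAt_linForm]; exact hWP hj⟩
    obtain rfl := eq_formsAt h2 hWP
    rw [← mult_eq_multIn hc, ← pointIdeal_eq_formIdeal]
    exact hfP P hP

end Points

end LineArrangement

theorem proposition2p6 {K : Type*} [Field K] [CharZero K] {n : ℕ}
    (ℓ : Fin n → MvPolynomial (Fin 3) K)
    (hℓ : LineArrangement.IsArrangement ℓ) (hess : LineArrangement.IsEssential ℓ) :
    -- the singular points are finitely many, `P_1, …, P_s`
    (LineArrangement.sing ℓ).Finite ∧
    -- the decomposition
    LineArrangement.foldIdeal (n - 2) ℓ =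
      (⨅ P ∈ LineArrangement.sing ℓ,
        LineArrangement.pointIdeal P ^ (LineArrangement.mult ℓ P - 2)) ⊓
      Ideal.span {MvPolynomial.X 0, MvPolynomial.X 1, MvPolynomial.X 2} ^ (n - 2) ∧
    -- no subtraction is truncated: the multiplicities and `n` are at least `2`
    (∀ P ∈ LineArrangement.sing ℓ, 2 ≤ LineArrangement.mult ℓ P) ∧ 2 < n ∧
    -- its components are primary (those with `n_P = 2` are the whole ring and are omitted)
    (∀ P ∈ LineArrangement.sing ℓ, 2 < LineArrangement.mult ℓ P →
      (LineArrangement.pointIdeal P ^ (LineArrangement.mult ℓ P - 2)).IsPrimary) ∧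
    (Ideal.span {MvPolynomial.X 0, MvPolynomial.X 1, MvPolynomial.X 2} ^ (n - 2) :
      Ideal (MvPolynomial (Fin 3) K)).IsPrimary := by
  have hn : 2 < n := by
    have h := LineArrangement.rank_le hℓ
    rw [hess] at h
    exact_mod_cast h
  refine ⟨LineArrangement.sing_finite hℓ, LineArrangement.foldIdeal_eq_iInf_inf hℓ hn.le,
    fun P hP => LineArrangement.two_le_mult hP, hn, fun P _ hm => ?_, ?_⟩
  · rw [LineArrangement.pointIdeal_eq_formIdeal]
    exact LineArrangement.formIdeal_pow_isPrimary _ (Nat.sub_ne_zero_of_lt hm)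
  · rw [← LineArrangement.formIdeal_top]
    exact LineArrangement.formIdeal_pow_isPrimary _ (Nat.sub_ne_zero_of_lt hn)
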